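/- Let $F\in\mathbb R^{n\times n}$, $G\in\mathbb R^{n\times m}$, let $S\in\mathbb R^{m\times m}$ and $P_0\in\mathbb R^{n\times n}$ be symmetric positive semidefinite, and let $\mu_0\in\mathbb R^n$, $t_0\in\mathbb R$. Consider the linear time-invariant error-state model $$\dot{\delta x}(t)=F\,\delta x(t)+G\,w(t),\qquad t\ge t_0,$$ where $w$ is zero-mean Gaussian white noise with power spectral density $S$. This is understood in the integrated sense: almost surely, for all $t\ge t_0$, $\delta x$ is integrable on $[t_0,t]$ and $$\delta x(t)=\delta x(t_0)+\int_{t_0}^t F\,\delta x(s)\,ds+G\,(W(t)-W(t_0)),$$ where $W$ is an $m$-dimensional Wiener process on $[t_0,\infty)$ with intensity $S$, that is, $W(t_0)=0$ almost surely, the increments $W(t)-W(s)\sim\mathcal N(0,(t-s)S)$ over disjoint intervals are independent, and the paths are almost surely continuous. For $\tau\ge 0$ put $$\Phi(\tau)=e^{F\tau},\qquad Q(\tau)=\int_0^\tau \Phi(r)\,G\,S\,G^{T}\,\Phi(r)^{T}\,dr .$$ Suppose that $\delta x(t_0)\sim\mathcal N(\mu_0,P_0)$ and that $\delta x(t_0)$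 is independent of the noise $(W(t))_{t\ge t_0}$. Then, for every $t\ge t_0$, with $\tau=t-t_0$, $$\delta x(t)\sim\mathcal N\bigl(\Phi(\tau)\mu_0,\;P(t)\bigr),\qquad P(t)=\Phi(\tau)P_0\Phi(\tau)^{T}+Q(\tau),$$ where $P(t)$ is positive semidefinite. Moreover, $(\delta x(t))_{t\ge t_0}$ is a linear Gaussian process: for all times $t_1,\dots,t_k\ge t_0$ the vector $(\delta x(t_1),\dots,\delta x(t_k))$ is jointly Gaussian, and for all $t_0\le s\le t$ the matrix $Q(t-s)$ is positive semidefinite and the residual $\delta x(t)-\Phi(t-s)\,\delta x(s)$ has law $\mathcal N(0,Q(t-s))$ and is independent of $(\delta x(u))_{t_0\le u\le s}$. -/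

import Mathlib

open MeasureTheory ProbabilityTheory
open scoped Matrix

namespace ErrorState

noncomputable section

/-- The state-transition matrix `Φ(τ) = exp (τ F)`. -/
def transition {ι : Type*} [Fintype ι] [DecidableEq ι] (F : Matrix ι ι ℝ) (τ : ℝ) :
    Matrix ι ι ℝ :=
  NormedSpace.exp (τ • F)

/-- The process noise covariance `Q(τ) = ∫₀^τ Φ(r) G S Gᵀ Φ(r)ᵀ dr` accumulated over an interval of
length `τ`, where `S` is the power spectral density of the noise; the matrix integral is taken
entry by entry. -/
def noiseCov {ι κ : Type*} [Fintype ι] [DecidableEq ι] [Fintype κ]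
    (F : Matrix ι ι ℝ) (G : Matrix ι κ ℝ) (S : Matrix κ κ ℝ) (τ : ℝ) : Matrix ι ι ℝ :=
  Matrix.of fun i j ↦ ∫ r in (0 : ℝ)..τ, (transition F r * G * S * Gᵀ * (transition F r)ᵀ) i j

/-- The error-state covariance `Φ(τ) P₀ Φ(τ)ᵀ + Q(τ)` after elapsed time `τ`. -/
def errorCov {ι κ : Type*} [Fintype ι] [DecidableEq ι] [Fintype κ]
    (F : Matrix ι ι ℝ) (G : Matrix ι κ ℝ) (S : Matrix κ κ ℝ) (P₀ : Matrix ι ι ℝ) (τ : ℝ) :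
    Matrix ι ι ℝ :=
  transition F τ * P₀ * (transition F τ)ᵀ + noiseCov F G S τ

/-- `W` is, on `[t₀, ∞)`, a `κ`-dimensional Wiener process with intensity matrix `S`:
it starts at `0` at time `t₀`, has independent increments `W t - W s ∼ N(0, (t - s) S)`, and has
almost surely continuous paths. Zero-mean Gaussian white noise `w` with power spectral density `S`,
that is `E[w(s) w(t)ᵀ] = S δ(t - s)`, is the formal derivative of such a process:
`W t = ∫ s in t₀..t, w s`. -/
structure IsWienerProcess {Ω κ : Type*} {mΩ : MeasurableSpace Ω} [Fintype κ] [DecidableEq κ]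
    (S : Matrix κ κ ℝ) (t₀ : ℝ) (W : ℝ → Ω → EuclideanSpace ℝ κ) (P : Measure Ω) : Prop where
  start : ∀ᵐ ω ∂P, W t₀ ω = 0
  indep_increments : HasIndepIncrements (fun t : Set.Ici t₀ ↦ W t) P
  law_increments : ∀ s t : ℝ, t₀ ≤ s → s ≤ t →
    HasLaw (fun ω ↦ W t ω - W s ω) (multivariateGaussian 0 ((t - s) • S)) P
  continuous_paths : ∀ᵐ ω ∂P, ContinuousOn (fun t ↦ W t ω) (Set.Ici t₀)

/-- `X` solves `Ẋ = F X + G w` on `[t₀, ∞)`, where the white noise `w` is the formal derivative of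
`W`. As usual for additive noise, this is the integrated equation
`X t = X t₀ + ∫ s in t₀..t, F (X s) + G (W t - W t₀)`, holding for all `t ≥ t₀` simultaneously,
almost surely. Paths are only required to be locally integrable, so that the integral makes sense;
if `W` has continuous paths, so has `X`. -/
def IsSolution {Ω ι κ : Type*} {mΩ : MeasurableSpace Ω} [Fintype ι] [DecidableEq ι]
    [Fintype κ] [DecidableEq κ] (F : Matrix ι ι ℝ) (G : Matrix ι κ ℝ) (t₀ : ℝ)
    (W : ℝ → Ω → EuclideanSpace ℝ κ) (X : ℝ → Ω → EuclideanSpace ℝ ι) (P : Measure Ω) : Prop :=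
  ∀ᵐ ω ∂P, ∀ t : ℝ, t₀ ≤ t →
    IntervalIntegrable (fun s ↦ X s ω) volume t₀ t ∧
    X t ω = X t₀ ω + (∫ s in t₀..t, F.toEuclideanLin (X s ω))
      + G.toEuclideanLin (W t ω - W t₀ ω)

/-- `X` is, on `[t₀, ∞)`, a linear Gaussian process with transition matrices `Φ τ` and noise
covariances `Q τ`: all its finite-dimensional distributions are Gaussian, and for `t₀ ≤ s ≤ t`
one has `X t = Φ (t - s) X s + η`, where `η ∼ N(0, Q (t - s))` is independent of the past
`(X u)`, `t₀ ≤ u ≤ s`. -/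
structure IsLinearGaussianProcess {Ω ι : Type*} {mΩ : MeasurableSpace Ω} [Fintype ι]
    [DecidableEq ι] (Φ Q : ℝ → Matrix ι ι ℝ) (t₀ : ℝ) (X : ℝ → Ω → EuclideanSpace ℝ ι)
    (P : Measure Ω) : Prop where
  gaussian : IsGaussianProcess (fun t : Set.Ici t₀ ↦ X t) P
  cov_posSemidef : ∀ s t : ℝ, t₀ ≤ s → s ≤ t → (Q (t - s)).PosSemidef
  law_residual : ∀ s t : ℝ, t₀ ≤ s → s ≤ t →
    HasLaw (fun ω ↦ X t ω - (Φ (t - s)).toEuclideanLin (X s ω))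
      (multivariateGaussian 0 (Q (t - s))) P
  indep_residual : ∀ s t : ℝ, t₀ ≤ s → s ≤ t →
    IndepFun (fun ω ↦ X t ω - (Φ (t - s)).toEuclideanLin (X s ω))
      (fun ω (u : Set.Icc t₀ s) ↦ X u ω) P

end

end ErrorState

/-! No stochastic integral is needed: the noise is additive with a smooth deterministic coefficient,
so variation of constants works path by path. For almost every path, the residual `X t - Φ(t - s) X
s` is the limit of the Riemann–Stieltjes sums `∑ₖ Φ(t - rₖ) G (W rₖ₊₁ - W rₖ)` over regular
subdivisions of `[s, t]` (`tendsto_sum_exp_gridPoint`, `IsSolution.tendsto_wienerSum`).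

These sums are linear in finitely many values of `W`. Together with the initial state they form a
Gaussian process whose mean function does not depend on the subdivision. Almost sure limits of such
processes are Gaussian, and their covariances converge (`isGaussianProcess_of_tendsto`,
`tendsto_covariance_of_tendsto`). Everything about second moments may therefore be computed on the
sums. Independent increments make the variances Riemann sums for the quadratic form of `noiseCov`.
They also make sums over non-overlapping intervals uncorrelated, and independence of the noise makes
the sums uncorrelated with the initial state.

In the limit, the residual over `[s, t]` is uncorrelated with every `X u`, `u ≤ s`, since `X u` is a
linear function of the initial state and the residual over `[t₀, u]`. Joint Gaussianity turns this
into independence of the whole past. The law of `X t` is read off from `X t = Φ(t - t₀) X t₀ +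
residual`. -/

namespace ErrorState

open Filter Topology Set

/-! ### Regular subdivisions of an interval -/

/-- The `k`-th node of the subdivision of `[s, t]` into `n` intervals of equal length. -/
noncomputable def gridPoint (s t : ℝ) (n k : ℕ) : ℝ := s + k * ((t - s) / n)

@[simp]
lemma gridPoint_zero (s t : ℝ) (n : ℕ) : gridPoint s t n 0 = s := by simp [gridPoint]

lemma gridPoint_self (s t : ℝ) {n : ℕ} (hn : n ≠ 0) : gridPoint s t n n = t := by
  have : (n : ℝ) ≠ 0 := by exact_mod_cast hn
  simp only [gridPoint]
  field_simp
  ring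

lemma gridPoint_succ_sub (s t : ℝ) (n k : ℕ) :
    gridPoint s t n (k + 1) - gridPoint s t n k = (t - s) / n := by
  simp only [gridPoint, Nat.cast_add, Nat.cast_one]
  ring

lemma monotone_gridPoint {s t : ℝ} (hst : s ≤ t) (n : ℕ) : Monotone (gridPoint s t n) := by
  refine monotone_nat_of_le_succ fun k ↦ ?_
  have := gridPoint_succ_sub s t n k
  have : 0 ≤ (t - s) / n := div_nonneg (by linarith) (Nat.cast_nonneg n)
  linarith

lemma le_gridPoint {s t : ℝ} (hst : s ≤ t) (n k : ℕ) : s ≤ gridPoint s t n k := by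
  simpa using monotone_gridPoint hst n (Nat.zero_le k)

lemma gridPoint_mem_Icc {s t : ℝ} (hst : s ≤ t) {n k : ℕ} (hk : k ≤ n) :
    gridPoint s t n k ∈ Icc s t := by
  refine ⟨le_gridPoint hst n k, ?_⟩
  obtain rfl | hn := eq_or_ne n 0
  · simpa [gridPoint] using hst
  · simpa [gridPoint_self s t hn] using monotone_gridPoint hst n hk

/-! ### Riemann and Riemann–Stieltjes sums along a path -/

section Deterministic

variable {E : Type*} [NormedAddCommGroup E] [NormedSpace ℝ E]

/-- Uniform continuity on the compact cube, together with vanishing on the diagonal, makes `K`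
uniformly small once both nodes are close to `r`. The sum is then at most a small constant times `t
- s`. This is the error estimate behind both kinds of sums below. -/
lemma tendsto_sum_integral_gridPoint {s t : ℝ} (hst : s ≤ t) {K : ℝ × ℝ × ℝ → E}
    (hK : ContinuousOn K (Icc s t ×ˢ Icc s t ×ˢ Icc s t))
    (hdiag : ∀ r ∈ Icc s t, K (r, r, r) = 0) :
    Tendsto (fun n : ℕ ↦ ∑ k ∈ Finset.range n,
      ∫ r in gridPoint s t n k..gridPoint s t n (k + 1),
        K (gridPoint s t n k, gridPoint s t n (k + 1), r)) atTop (𝓝 0) := by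
  have hu := (isCompact_Icc.prod (isCompact_Icc.prod
    isCompact_Icc)).uniformContinuousOn_of_continuous hK
  rw [Metric.uniformContinuousOn_iff] at hu
  rw [Metric.tendsto_atTop]
  intro ε hε
  -- The `+ 1` keeps the denominator positive when `s = t` and makes the final inequality strict.
  have hpos : 0 < t - s + 1 := by linarith
  obtain ⟨δ, hδ, hKδ⟩ := hu (ε / (t - s + 1)) (by positivity)
  obtain ⟨N, hN⟩ := exists_nat_gt ((t - s) / δ)
  refine ⟨N + 1, fun n hn ↦ ?_⟩
  have hn0 : n ≠ 0 := by omega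
  have hnpos : (0 : ℝ) < n := by exact_mod_cast Nat.pos_of_ne_zero hn0
  have hNn : (N : ℝ) < n := by exact_mod_cast hn
  have hstep : (t - s) / n < δ := by
    rw [div_lt_iff₀ hnpos]
    rw [div_lt_iff₀ hδ] at hN
    nlinarith
  have hbound : ∀ k ∈ Finset.range n, ‖∫ r in gridPoint s t n k..gridPoint s t n (k + 1),
      K (gridPoint s t n k, gridPoint s t n (k + 1), r)‖ ≤
      ε / (t - s + 1) * ((t - s) / n) := by
    intro k hk
    have hkn : k < n := Finset.mem_range.1 hk
    have hle := monotone_gridPoint hst n (Nat.le_succ k)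
    have hsub := gridPoint_succ_sub s t n k
    have ha := gridPoint_mem_Icc hst hkn.le
    have hb := gridPoint_mem_Icc hst (Nat.succ_le_of_lt hkn)
    simp only [Nat.succ_eq_add_one] at hle hb
    have := intervalIntegral.norm_integral_le_of_norm_le_const (a := gridPoint s t n k)
      (b := gridPoint s t n (k + 1)) (C := ε / (t - s + 1))
      (f := fun r ↦ K (gridPoint s t n k, gridPoint s t n (k + 1), r)) ?_
    · rwa [hsub, abs_of_nonneg (by rw [← hsub]; linarith)] at this
    · intro r hr
      rw [uIoc_of_le hle] at hr
      have hr' : r ∈ Icc s t := ⟨ha.1.trans hr.1.le, hr.2.trans hb.2⟩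
      have h1 := hKδ (gridPoint s t n k, gridPoint s t n (k + 1), r) ⟨ha, hb, hr'⟩ (r, r, r)
        ⟨hr', hr', hr'⟩ ?_
      · rw [hdiag r hr', dist_zero_right] at h1
        exact h1.le
      · simp only [Prod.dist_eq, Real.dist_eq, sub_self, abs_zero]
        have h2 : |gridPoint s t n k - r| < δ := by
          rw [abs_lt]; constructor <;> linarith [hr.1, hr.2]
        have h3 : |gridPoint s t n (k + 1) - r| < δ := by
          rw [abs_lt]; constructor <;> linarith [hr.1, hr.2]
        simp [h2, h3]
  rw [dist_zero_right]
  calc _ ≤ ∑ k ∈ Finset.range n, ε / (t - s + 1) * ((t - s) / n) := norm_sum_le_of_le _ hbound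
    _ = ε * ((t - s) / (t - s + 1)) := by
      rw [Finset.sum_const, Finset.card_range, nsmul_eq_mul]
      field_simp
    _ < ε * 1 := by
      gcongr
      rw [div_lt_one hpos]
      linarith
    _ = ε := mul_one ε

/-- Left Riemann sums of a continuous function converge to its integral. -/
lemma tendsto_sum_smul_gridPoint [CompleteSpace E] {s t : ℝ} (hst : s ≤ t) {f : ℝ → E}
    (hf : ContinuousOn f (Icc s t)) :
    Tendsto (fun n : ℕ ↦ ∑ k ∈ Finset.range n, ((t - s) / n) • f (gridPoint s t n k)) atTop
      (𝓝 (∫ r in s..t, f r)) := by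
  have hK : ContinuousOn (fun p : ℝ × ℝ × ℝ ↦ f p.1 - f p.2.2)
      (Icc s t ×ˢ Icc s t ×ˢ Icc s t) :=
    (hf.comp continuousOn_fst fun p hp ↦ hp.1).sub
      (hf.comp (by fun_prop) fun p hp ↦ hp.2.2)
  have h := (tendsto_sum_integral_gridPoint hst hK (by simp)).add_const (∫ r in s..t, f r)
  rw [zero_add] at h
  refine h.congr' ?_
  filter_upwards [eventually_ne_atTop 0] with n hn
  have hint : ∀ k < n, IntervalIntegrable f volume (gridPoint s t n k)
      (gridPoint s t n (k + 1)) := fun k hk ↦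
    (hf.mono (uIcc_subset_Icc (gridPoint_mem_Icc hst hk.le)
      (gridPoint_mem_Icc hst hk))).intervalIntegrable
  have htot := intervalIntegral.sum_integral_adjacent_intervals hint
  rw [gridPoint_zero, gridPoint_self s t hn] at htot
  rw [← htot, ← Finset.sum_add_distrib]
  refine Finset.sum_congr rfl fun k hk ↦ ?_
  rw [intervalIntegral.integral_sub intervalIntegrable_const (hint k (Finset.mem_range.1 hk)),
    intervalIntegral.integral_const, gridPoint_succ_sub, sub_add_cancel]

variable [CompleteSpace E]

lemma continuous_exp_sub_smul (A : E →L[ℝ] E) (t : ℝ) :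
    Continuous fun r : ℝ ↦ NormedSpace.exp ((t - r) • A) :=
  continuous_iff_continuousAt.2 fun r ↦
    ((hasDerivAt_exp_smul_const A (t - r)).continuousAt).comp (f := fun r : ℝ ↦ t - r)
      (by fun_prop)

lemma integral_exp_sub_smul_mul (A : E →L[ℝ] E) (t a b : ℝ) (y : E) :
    ∫ r in a..b, NormedSpace.exp ((t - r) • A) (A y) =
      NormedSpace.exp ((t - a) • A) y - NormedSpace.exp ((t - b) • A) y := by
  have hderiv : ∀ r : ℝ, HasDerivAt (fun r ↦ - NormedSpace.exp ((t - r) • A) y)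
      (NormedSpace.exp ((t - r) • A) (A y)) r := by
    intro r
    have h1 := (hasDerivAt_exp_smul_const A (t - r)).scomp r ((hasDerivAt_id r).const_sub t)
    have h2 := (h1.clm_apply (hasDerivAt_const r y)).fun_neg
    simpa using h2
  rw [intervalIntegral.integral_eq_sub_of_hasDerivAt (fun r _ ↦ hderiv r)]
  · abel
  · exact (((continuous_exp_sub_smul A t).clm_apply continuous_const)).intervalIntegrable _ _

/-- The residual of a solution of `dx = A x + dg` is a limit of Riemann–Stieltjes sums. -/
lemma tendsto_sum_exp_gridPoint (A : E →L[ℝ] E) {x g : ℝ → E} {s t : ℝ} (hst : s ≤ t)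
    (hx : ContinuousOn x (Icc s t))
    (h : ∀ u v, s ≤ u → u ≤ v → v ≤ t → x v - x u = (∫ r in u..v, A (x r)) + (g v - g u)) :
    Tendsto (fun n : ℕ ↦ ∑ k ∈ Finset.range n,
        NormedSpace.exp ((t - gridPoint s t n k) • A)
          (g (gridPoint s t n (k + 1)) - g (gridPoint s t n k))) atTop
      (𝓝 (x t - NormedSpace.exp ((t - s) • A) (x s))) := by
  -- The integral of `K` over a cell `[a, b]` is the exact difference between the telescoping
  -- increment of `e^{(t - r)A} x r` and the term `e^{(t - a)A} (g b - g a)`. The first part comes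
  -- from the drift in the equation, the second from the variation of the exponential applied to `x
  -- b`. Nothing is asked of `g` beyond the equation itself.
  let K : ℝ × ℝ × ℝ → E := fun p ↦ NormedSpace.exp ((t - p.1) • A) (A (x p.2.2)) -
    NormedSpace.exp ((t - p.2.2) • A) (A (x p.2.1))
  have hexp := continuous_exp_sub_smul A t
  have hK : ContinuousOn K (Icc s t ×ˢ Icc s t ×ˢ Icc s t) := by
    refine ContinuousOn.sub (ContinuousOn.clm_apply ?_ ?_) (ContinuousOn.clm_apply ?_ ?_)
    · exact (hexp.comp continuous_fst).continuousOn
    · exact A.continuous.comp_continuousOn (hx.comp (by fun_prop) fun p hp ↦ hp.2.2)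
    · exact (hexp.comp (continuous_snd.comp continuous_snd)).continuousOn
    · exact A.continuous.comp_continuousOn (hx.comp (by fun_prop) fun p hp ↦ hp.2.1)
  have hlim := (tendsto_sum_integral_gridPoint hst hK (by simp [K])).const_sub
    (x t - NormedSpace.exp ((t - s) • A) (x s))
  rw [sub_zero] at hlim
  refine hlim.congr' ?_
  filter_upwards [eventually_ne_atTop 0] with n hn
  have htel := Finset.sum_range_sub (fun k ↦ NormedSpace.exp ((t - gridPoint s t n k) • A)
    (x (gridPoint s t n k))) n
  simp only [gridPoint_zero, gridPoint_self s t hn, sub_self, zero_smul, NormedSpace.exp_zero,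
    one_apply_eq_self] at htel
  rw [← htel, ← Finset.sum_sub_distrib]
  refine Finset.sum_congr rfl fun k hk ↦ ?_
  have hkn : k < n := Finset.mem_range.1 hk
  have ha := gridPoint_mem_Icc hst hkn.le
  have hb := gridPoint_mem_Icc hst (Nat.succ_le_of_lt hkn)
  have hle := monotone_gridPoint hst n (Nat.le_succ k)
  simp only [Nat.succ_eq_add_one] at hb hle
  generalize gridPoint s t n k = a at *
  generalize gridPoint s t n (k + 1) = b at *
  have hAx : IntervalIntegrable (fun r ↦ A (x r)) volume a b :=
    (A.continuous.comp_continuousOn (hx.mono (uIcc_subset_Icc ha hb))).intervalIntegrable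
  have h1 : IntervalIntegrable (fun r ↦ NormedSpace.exp ((t - a) • A) (A (x r))) volume a b :=
    ((NormedSpace.exp ((t - a) • A)).continuous.comp_continuousOn
      (A.continuous.comp_continuousOn (hx.mono (uIcc_subset_Icc ha hb)))).intervalIntegrable
  simp only [K]
  rw [intervalIntegral.integral_sub h1
    ((hexp.clm_apply continuous_const).intervalIntegrable _ _), integral_exp_sub_smul_mul,
    ContinuousLinearMap.intervalIntegral_comp_comm _ hAx,
    eq_sub_of_add_eq' (h a b ha.1 hle hb.2).symm, map_sub, map_sub]
  abel

end Deterministic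

/-! ### Almost sure limits of Gaussian variables and processes -/

section GaussianLimit

variable {Ω : Type*} {mΩ : MeasurableSpace Ω} {P : Measure Ω}

lemma tendsto_charFun_map_of_ae [IsProbabilityMeasure P] {Y : ℕ → Ω → ℝ} {Z : Ω → ℝ}
    (hY : ∀ n, AEMeasurable (Y n) P) (hlim : ∀ᵐ ω ∂P, Tendsto (fun n ↦ Y n ω) atTop (𝓝 (Z ω)))
    (u : ℝ) :
    Tendsto (fun n ↦ charFun (P.map (Y n)) u) atTop (𝓝 (charFun (P.map Z) u)) := by
  have hZ : AEMeasurable Z P := aemeasurable_of_tendsto_metrizable_ae' hY hlim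
  have key : ∀ {X : Ω → ℝ}, AEMeasurable X P →
      charFun (P.map X) u = ∫ ω, Complex.exp (u * X ω * Complex.I) ∂P := by
    intro X hX
    rw [charFun_apply_real, integral_map hX (by fun_prop)]
  simp_rw [fun n ↦ key (hY n), key hZ]
  refine tendsto_integral_of_dominated_convergence (fun _ ↦ 1) (fun n ↦ ?_)
    (integrable_const _) (fun n ↦ ae_of_all _ fun ω ↦ ?_) ?_
  · have := hY n
    exact AEMeasurable.aestronglyMeasurable (by fun_prop)
  · rw [← Complex.ofReal_mul, Complex.norm_exp_ofReal_mul_I]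
  · filter_upwards [hlim] with ω hω
    have hc : Continuous fun y : ℝ ↦ Complex.exp (u * y * Complex.I) := by fun_prop
    exact (hc.tendsto _).comp hω

/-- An almost sure limit of real Gaussian random variables with common mean is Gaussian, and the
variances converge. -/
lemma hasGaussianLaw_of_tendsto_real {Y : ℕ → Ω → ℝ} {Z : Ω → ℝ} {m : ℝ}
    (hY : ∀ n, HasGaussianLaw (Y n) P) (hm : ∀ n, ∫ ω, Y n ω ∂P = m)
    (hlim : ∀ᵐ ω ∂P, Tendsto (fun n ↦ Y n ω) atTop (𝓝 (Z ω))) :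
    HasGaussianLaw Z P ∧ ∫ ω, Z ω ∂P = m ∧
      Tendsto (fun n ↦ Var[Y n; P]) atTop (𝓝 Var[Z; P]) := by
  have : IsProbabilityMeasure P := (hY 0).isProbabilityMeasure
  have hZ : AEMeasurable Z P :=
    aemeasurable_of_tendsto_metrizable_ae' (fun n ↦ (hY n).aemeasurable) hlim
  have : IsProbabilityMeasure (P.map Z) := Measure.isProbabilityMeasure_map hZ
  have hlaw : ∀ n, P.map (Y n) = gaussianReal m (Var[Y n; P]).toNNReal := by
    intro n
    rw [(hY n).isGaussian_map.eq_gaussianReal, integral_map (hY n).aemeasurable (by fun_prop),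
      variance_map (by fun_prop) (hY n).aemeasurable]
    simp [← hm n]
  have hchar : ∀ u : ℝ, Tendsto (fun n ↦ Complex.exp (u * m * Complex.I -
      (Var[Y n; P] : ℝ) * u ^ 2 / 2)) atTop (𝓝 (charFun (P.map Z) u)) := by
    intro u
    refine (tendsto_charFun_map_of_ae (fun n ↦ (hY n).aemeasurable) hlim u).congr fun n ↦ ?_
    rw [hlaw n, charFun_gaussianReal, Real.coe_toNNReal _ (variance_nonneg _ _)]
  -- The limiting characteristic function is continuous and equals `1` at `0`, so it is nonzero at
  -- some `u ≠ 0`. There the modulus `exp (-Var u² / 2)` has a nonzero limit, and taking logarithms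
  -- forces the variances to converge.
  obtain ⟨u, hu0, hu⟩ : ∃ u : ℝ, u ≠ 0 ∧ charFun (P.map Z) u ≠ 0 := by
    have hcont : ContinuousAt (charFun (P.map Z)) 0 := continuous_charFun.continuousAt
    have hne : charFun (P.map Z) 0 ≠ 0 := by simp
    have h1 := (hcont.eventually_ne hne).filter_mono (nhdsWithin_le_nhds (s := {0}ᶜ))
    obtain ⟨u, hu⟩ := (h1.and self_mem_nhdsWithin).exists
    exact ⟨u, hu.2, hu.1⟩
  obtain ⟨v, hv⟩ : ∃ v : ℝ, Tendsto (fun n ↦ Var[Y n; P]) atTop (𝓝 v) := by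
    have h1 := (hchar u).norm
    have h2 := ((Real.continuousAt_log (norm_ne_zero_iff.2 hu)).tendsto.comp h1).const_mul
      (-2 / u ^ 2)
    refine ⟨_, h2.congr fun n ↦ ?_⟩
    have h3 : (u * m * Complex.I - (Var[Y n; P] : ℝ) * u ^ 2 / 2 : ℂ).re =
        - (Var[Y n; P] * u ^ 2 / 2) := by
      have : (u * m * Complex.I - (Var[Y n; P] : ℝ) * u ^ 2 / 2 : ℂ) =
        ((u * m : ℝ) : ℂ) * Complex.I - ((Var[Y n; P] * u ^ 2 / 2 : ℝ) : ℂ) := by push_cast; ring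
      rw [this]
      simp only [Complex.sub_re, Complex.re_ofReal_mul, Complex.I_re, Complex.ofReal_re]
      ring
    simp only [Function.comp_apply]
    rw [Complex.norm_exp, h3, Real.log_exp]
    field_simp
  have hv0 : 0 ≤ v := ge_of_tendsto' hv fun n ↦ variance_nonneg _ _
  have hZlaw : P.map Z = gaussianReal m v.toNNReal := by
    refine Measure.ext_of_charFun (funext fun u ↦ tendsto_nhds_unique (hchar u) ?_)
    rw [charFun_gaussianReal, Real.coe_toNNReal _ hv0]
    have hc : Continuous fun w : ℝ ↦ Complex.exp (u * m * Complex.I - w * u ^ 2 / 2) := by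
      fun_prop
    exact (hc.tendsto v).comp hv
  have hZ' : HasLaw Z (gaussianReal m v.toNNReal) P := ⟨hZ, hZlaw⟩
  refine ⟨⟨by rw [hZlaw]; infer_instance⟩, ?_, ?_⟩
  · rw [hZ'.integral_eq, integral_id_gaussianReal]
  · rw [hZ'.variance_eq, variance_id_gaussianReal, Real.coe_toNNReal _ hv0]
    exact hv

variable {T E : Type*} [NormedAddCommGroup E] [NormedSpace ℝ E] [MeasurableSpace E] [BorelSpace E]
  [SecondCountableTopology E] [CompleteSpace E]

/-- A pointwise almost sure limit of Gaussian processes with common mean function is Gaussian. -/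
lemma isGaussianProcess_of_tendsto {Y : ℕ → T → Ω → E} {Z : T → Ω → E} {m : T → E}
    (hY : ∀ n, IsGaussianProcess (Y n) P) (hm : ∀ n t, ∫ ω, Y n t ω ∂P = m t)
    (hlim : ∀ t, ∀ᵐ ω ∂P, Tendsto (fun n ↦ Y n t ω) atTop (𝓝 (Z t ω))) :
    IsGaussianProcess Z P where
  hasGaussianLaw I := by
    have hZ : ∀ t, AEMeasurable (Z t) P := fun t ↦
      aemeasurable_of_tendsto_metrizable_ae' (fun n ↦ (hY n).aemeasurable t) (hlim t)
    have hZI : AEMeasurable (fun ω ↦ I.restrict (Z · ω)) P :=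
      aemeasurable_pi_lambda _ fun i ↦ hZ i
    -- Cramér–Wold: it suffices to treat each continuous linear functional of the finite-dimensional
    -- marginal, which is the real case.
    refine ⟨isGaussian_of_isGaussian_map fun L ↦ ?_⟩
    rw [AEMeasurable.map_map_of_aemeasurable (by fun_prop) hZI]
    refine (hasGaussianLaw_of_tendsto_real (m := L fun i ↦ m i)
      (fun n ↦ ((hY n).hasGaussianLaw I).map L) (fun n ↦ ?_) ?_).1.isGaussian_map
    · have hint := ((hY n).hasGaussianLaw I).integrable
      simp only [Function.comp_apply]
      rw [L.integral_comp_comm hint]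
      congr 1
      ext i
      rw [eval_integral]
      · exact hm n i
      · exact fun j ↦ ((hY n).hasGaussianLaw_eval j).integrable
    · have : ∀ᵐ ω ∂P, ∀ i : I, Tendsto (fun n ↦ Y n i ω) atTop (𝓝 (Z i ω)) :=
        ae_all_iff.2 fun i ↦ hlim i
      filter_upwards [this] with ω hω
      exact (L.continuous.tendsto _).comp (tendsto_pi_nhds.2 hω)

/-- Continuous functionals separate points and commute with the integral, so the real case suffices.
Gaussianity of the limit supplies its integrability. -/
lemma integral_eq_of_tendsto_gaussian {Y : ℕ → Ω → E} {Z : Ω → E} {m : E}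
    (hY : ∀ n, HasGaussianLaw (Y n) P) (hm : ∀ n, ∫ ω, Y n ω ∂P = m)
    (hZ : HasGaussianLaw Z P)
    (hlim : ∀ᵐ ω ∂P, Tendsto (fun n ↦ Y n ω) atTop (𝓝 (Z ω))) :
    ∫ ω, Z ω ∂P = m := by
  refine (SeparatingDual.eq_iff_forall_dual_eq (R := ℝ)).2 fun L ↦ ?_
  rw [← L.integral_comp_comm hZ.integrable]
  refine (hasGaussianLaw_of_tendsto_real (fun n ↦ (hY n).map_fun L) (fun n ↦ ?_) ?_).2.1
  · rw [L.integral_comp_comm (hY n).integrable, hm]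
  · filter_upwards [hlim] with ω hω using (L.continuous.tendsto _).comp hω

/-- Covariances of Gaussian processes with common mean function converge along pointwise almost
sure limits. -/
lemma tendsto_covariance_of_tendsto {Y : ℕ → T → Ω → E} {Z : T → Ω → E} {m : T → E}
    (hY : ∀ n, IsGaussianProcess (Y n) P) (hm : ∀ n t, ∫ ω, Y n t ω ∂P = m t)
    (hlim : ∀ t, ∀ᵐ ω ∂P, Tendsto (fun n ↦ Y n t ω) atTop (𝓝 (Z t ω)))
    (s t : T) (L M : StrongDual ℝ E) :
    Tendsto (fun n ↦ cov[fun ω ↦ L (Y n s ω), fun ω ↦ M (Y n t ω); P]) atTop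
      (𝓝 cov[fun ω ↦ L (Z s ω), fun ω ↦ M (Z t ω); P]) := by
  have hZ := isGaussianProcess_of_tendsto hY hm hlim
  have : IsProbabilityMeasure P := hZ.isProbabilityMeasure
  -- Polarization: covariances are combinations of variances of Gaussian variables, whose
  -- convergence is already known.
  have key : ∀ {X : T → Ω → E}, IsGaussianProcess X P →
      cov[fun ω ↦ L (X s ω), fun ω ↦ M (X t ω); P] =
        (Var[fun ω ↦ L (X s ω) + M (X t ω); P] - Var[fun ω ↦ L (X s ω); P] -
          Var[fun ω ↦ M (X t ω); P]) / 2 := by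
    intro X hX
    rw [variance_fun_add ((hX.hasGaussianLaw_eval s).map_fun L).memLp_two
      ((hX.hasGaussianLaw_eval t).map_fun M).memLp_two]
    ring
  simp_rw [fun n ↦ key (hY n), key hZ]
  have hint : ∀ n t, Integrable (Y n t) P := fun n t ↦ ((hY n).hasGaussianLaw_eval t).integrable
  have single : ∀ (t : T) (L : StrongDual ℝ E),
      Tendsto (fun n ↦ Var[fun ω ↦ L (Y n t ω); P]) atTop (𝓝 Var[fun ω ↦ L (Z t ω); P]) := by
    intro t L
    refine (hasGaussianLaw_of_tendsto_real (m := L (m t))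
      (fun n ↦ ((hY n).hasGaussianLaw_eval t).map_fun L) (fun n ↦ ?_) ?_).2.2
    · rw [L.integral_comp_comm (hint n t), hm]
    · filter_upwards [hlim t] with ω hω using (L.continuous.tendsto _).comp hω
  refine ((Tendsto.sub ?_ (single s L)).sub (single t M)).div_const 2
  refine (hasGaussianLaw_of_tendsto_real (m := L (m s) + M (m t)) (fun n ↦ ?_)
    (fun n ↦ ?_) ?_).2.2
  · simpa using (hY n).hasGaussianLaw_prodMk (s := s) (t := t) |>.map_fun (L.coprod M)
  · rw [integral_add (L.integrable_comp (hint n s)) (M.integrable_comp (hint n t)),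
      L.integral_comp_comm (hint n s), M.integral_comp_comm (hint n t), hm, hm]
  · filter_upwards [hlim s, hlim t] with ω hs ht
    exact ((L.continuous.tendsto _).comp hs).add ((M.continuous.tendsto _).comp ht)

end GaussianLimit

/-! ### The transition matrix and the noise covariance -/

section Transition

variable {ι κ : Type*} [Fintype ι] [DecidableEq ι] [Fintype κ]

lemma continuous_transition (F : Matrix ι ι ℝ) : Continuous (transition F) := by
  unfold transition
  open scoped Matrix.Norms.Operator in
  exact NormedSpace.exp_continuous.comp (continuous_id.smul continuous_const)

/-- An algebra isomorphism between finite-dimensional algebras is continuous, hence commutes with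
the exponential. This links the matrix exponential to the operator exponential of the pathwise
estimates. -/
lemma toEuclideanCLM_transition (F : Matrix ι ι ℝ) (τ : ℝ) :
    Matrix.toEuclideanCLM (𝕜 := ℝ) (transition F τ) =
      NormedSpace.exp (τ • Matrix.toEuclideanCLM (𝕜 := ℝ) F) := by
  unfold transition
  rw [← map_smul]
  open scoped Matrix.Norms.Operator in
  exact NormedSpace.map_exp (Matrix.toEuclideanCLM (𝕜 := ℝ) (n := ι))
    (LinearMap.continuous_of_finiteDimensional
      (Matrix.toEuclideanCLM (𝕜 := ℝ) (n := ι)).toAlgEquiv.toLinearMap) (τ • F)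

lemma toEuclideanLin_transition (F : Matrix ι ι ℝ) (τ : ℝ) (x : EuclideanSpace ℝ ι) :
    (transition F τ).toEuclideanLin x =
      NormedSpace.exp (τ • Matrix.toEuclideanCLM (𝕜 := ℝ) F) x := by
  rw [← toEuclideanCLM_transition]
  rfl

lemma inner_toEuclideanLin [DecidableEq κ] (M : Matrix ι κ ℝ) (x : EuclideanSpace ℝ ι)
    (w : EuclideanSpace ℝ κ) :
    inner ℝ x (M.toEuclideanLin w) = inner ℝ (Mᵀ.toEuclideanLin x) w := by
  simp only [EuclideanSpace.inner_eq_star_dotProduct, star_trivial,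
    Matrix.ofLp_toLpLin, Matrix.toLin'_apply, Matrix.mulVec_transpose]
  rw [dotProduct_comm, Matrix.dotProduct_mulVec, dotProduct_comm]

lemma continuous_noise_integrand (F : Matrix ι ι ℝ) (G : Matrix ι κ ℝ) (S : Matrix κ κ ℝ) :
    Continuous fun r ↦ transition F r * G * S * Gᵀ * (transition F r)ᵀ := by
  have := continuous_transition F
  fun_prop

/-- A quadratic form is a finite sum of entries, so it passes under the entrywise integral.
Positivity and Riemann-sum approximation of `noiseCov` thereby become scalar questions. -/
lemma dotProduct_noiseCov_mulVec (F : Matrix ι ι ℝ) (G : Matrix ι κ ℝ) (S : Matrix κ κ ℝ) (τ : ℝ)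
    (x : ι → ℝ) :
    x ⬝ᵥ noiseCov F G S τ *ᵥ x =
      ∫ r in (0 : ℝ)..τ, x ⬝ᵥ (transition F r * G * S * Gᵀ * (transition F r)ᵀ) *ᵥ x := by
  have hc := continuous_noise_integrand F G S
  simp only [dotProduct, Matrix.mulVec, noiseCov, Matrix.of_apply]
  rw [intervalIntegral.integral_finsetSum]
  · refine Finset.sum_congr rfl fun i _ ↦ ?_
    rw [intervalIntegral.integral_const_mul, intervalIntegral.integral_finsetSum]
    · simp_rw [intervalIntegral.integral_mul_const]
    · exact fun j _ ↦ Continuous.intervalIntegrable ((hc.matrix_elem i j).mul_const _) _ _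
  · exact fun i _ ↦ Continuous.intervalIntegrable (continuous_const.mul
      (continuous_finsetSum _ fun j _ ↦ (hc.matrix_elem i j).mul_const _)) _ _

lemma posSemidef_noise_integrand (F : Matrix ι ι ℝ) (G : Matrix ι κ ℝ) {S : Matrix κ κ ℝ}
    (hS : S.PosSemidef) (r : ℝ) :
    (transition F r * G * S * Gᵀ * (transition F r)ᵀ).PosSemidef := by
  simpa [Matrix.conjTranspose_eq_transpose_of_trivial, Matrix.transpose_mul, mul_assoc,
    Matrix.mul_assoc] using hS.mul_mul_conjTranspose_same (transition F r * G)

lemma posSemidef_noiseCov (F : Matrix ι ι ℝ) (G : Matrix ι κ ℝ) {S : Matrix κ κ ℝ}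
    (hS : S.PosSemidef) {τ : ℝ} (hτ : 0 ≤ τ) : (noiseCov F G S τ).PosSemidef := by
  rw [Matrix.posSemidef_iff_dotProduct_mulVec]
  constructor
  · ext i j
    simp only [Matrix.conjTranspose_apply, star_trivial, noiseCov, Matrix.of_apply]
    congr 1
    ext r
    simpa using (posSemidef_noise_integrand F G hS r).isHermitian.apply i j
  · intro x
    rw [star_trivial, dotProduct_noiseCov_mulVec]
    refine intervalIntegral.integral_nonneg hτ fun r _ ↦ ?_
    simpa using (Matrix.posSemidef_iff_dotProduct_mulVec.1
      (posSemidef_noise_integrand F G hS r)).2 x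

lemma posSemidef_errorCov (F : Matrix ι ι ℝ) (G : Matrix ι κ ℝ) {S : Matrix κ κ ℝ}
    (hS : S.PosSemidef) {P₀ : Matrix ι ι ℝ} (hP₀ : P₀.PosSemidef) {τ : ℝ} (hτ : 0 ≤ τ) :
    (errorCov F G S P₀ τ).PosSemidef := by
  refine Matrix.PosSemidef.add ?_ (posSemidef_noiseCov F G hS hτ)
  simpa [Matrix.conjTranspose_eq_transpose_of_trivial] using
    hP₀.mul_mul_conjTranspose_same (transition F τ)

/-- These are left Riemann sums in `r` of the integrand at `t - r`; the substitution `r ↦ t - r`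
turns their limit into `noiseCov`. The summands are the variances of the terms of `wienerSum`. -/
lemma tendsto_sum_noise_integrand (F : Matrix ι ι ℝ) (G : Matrix ι κ ℝ) (S : Matrix κ κ ℝ)
    {s t : ℝ} (hst : s ≤ t) (x : ι → ℝ) :
    Tendsto (fun n : ℕ ↦ ∑ k ∈ Finset.range n, ((t - s) / n) •
      (x ⬝ᵥ (transition F (t - gridPoint s t n k) * G *
        S * Gᵀ * (transition F (t - gridPoint s t n k))ᵀ) *ᵥ x)) atTop
      (𝓝 (x ⬝ᵥ noiseCov F G S (t - s) *ᵥ x)) := by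
  have hc : Continuous fun r ↦ x ⬝ᵥ (transition F r * G * S * Gᵀ * (transition F r)ᵀ) *ᵥ x :=
    continuous_const.dotProduct ((continuous_noise_integrand F G S).matrix_mulVec continuous_const)
  have h := tendsto_sum_smul_gridPoint hst
    (hc.comp (by fun_prop : Continuous fun r ↦ t - r)).continuousOn
  simp only [Function.comp_apply] at h
  rw [intervalIntegral.integral_comp_sub_left
    (fun r ↦ x ⬝ᵥ (transition F r * G * S * Gᵀ * (transition F r)ᵀ) *ᵥ x), sub_self,
    ← dotProduct_noiseCov_mulVec] at h
  exact h

end Transition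

/-! ### Pathwise variation of constants -/

section Pathwise

variable {Ω ι κ : Type*} {mΩ : MeasurableSpace Ω} [Fintype ι] [DecidableEq ι]
  [Fintype κ] [DecidableEq κ] {P : Measure Ω} {F : Matrix ι ι ℝ} {G : Matrix ι κ ℝ}
  {S : Matrix κ κ ℝ} {t₀ : ℝ} {W : ℝ → Ω → EuclideanSpace ℝ κ} {X : ℝ → Ω → EuclideanSpace ℝ ι}

/-- The sum `∑ₖ Φ(t - rₖ) G (W rₖ₊₁ - W rₖ)` over the `n`-th regular subdivision of `[s, t]`. -/
noncomputable def wienerSum (F : Matrix ι ι ℝ) (G : Matrix ι κ ℝ) (W : ℝ → Ω → EuclideanSpace ℝ κ)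
    (n : ℕ) (s t : ℝ) (ω : Ω) : EuclideanSpace ℝ ι :=
  ∑ k ∈ Finset.range n, (transition F (t - gridPoint s t n k) * G).toEuclideanLin
    (W (gridPoint s t n (k + 1)) ω - W (gridPoint s t n k) ω)

lemma IsSolution.tendsto_wienerSum (hX : IsSolution F G t₀ W X P) (hW : IsWienerProcess S t₀ W P) :
    ∀ᵐ ω ∂P, ∀ s t, t₀ ≤ s → s ≤ t → Tendsto (fun n ↦ wienerSum F G W n s t ω) atTop
      (𝓝 (X t ω - (transition F (t - s)).toEuclideanLin (X s ω))) := by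
  filter_upwards [hX, hW.continuous_paths] with ω hω hcont s t hs hst
  have hG : Continuous G.toEuclideanLin := LinearMap.continuous_of_finiteDimensional _
  let A := Matrix.toEuclideanCLM (𝕜 := ℝ) F
  have hAint : ∀ t, t₀ ≤ t → IntervalIntegrable (fun r ↦ A (X r ω)) volume t₀ t := fun t ht ↦
    ⟨A.integrable_comp (hω t ht).1.1, A.integrable_comp (hω t ht).1.2⟩
  -- Only local integrability of the path is assumed. Continuity follows from the equation, as the
  -- primitive and the Wiener path are both continuous.
  have hcX : ContinuousOn (fun r ↦ X r ω) (Icc s t) := by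
    have ht : t₀ ≤ t := hs.trans hst
    have hprim := intervalIntegral.continuousOn_primitive_interval' (hAint t ht)
      left_mem_uIcc
    rw [uIcc_of_le ht] at hprim
    have hsum : ContinuousOn (fun u ↦ X t₀ ω + (∫ r in t₀..u, A (X r ω)) +
        G.toEuclideanLin (W u ω - W t₀ ω)) (Icc t₀ t) :=
      (continuousOn_const.add hprim).add (hG.comp_continuousOn
        ((hcont.mono Icc_subset_Ici_self).sub continuousOn_const))
    exact (hsum.congr fun u hu ↦ (hω u hu.1).2).mono (Icc_subset_Icc_left hs)
  have h := tendsto_sum_exp_gridPoint A (x := fun r ↦ X r ω)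
    (g := fun r ↦ G.toEuclideanLin (W r ω)) hst hcX ?_
  · simpa only [wienerSum, Matrix.toEuclideanLin, Matrix.toLpLin_mul_same, LinearMap.comp_apply,
      map_sub, toEuclideanLin_transition] using h
  -- Subtracting the equations at `v` and `u` leaves the integral over `[u, v]` and the noise
  -- increment.
  · intro u v hu huv _
    have hu' := hs.trans hu
    have hv' := hu'.trans huv
    have := intervalIntegral.integral_add_adjacent_intervals (hAint u hu')
      ((hAint u hu').symm.trans (hAint v hv'))
    have e1 := (hω u hu').2
    have e2 := (hω v hv').2
    change X u ω = X t₀ ω + (∫ r in t₀..u, A (X r ω)) + _ at e1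
    change X v ω = X t₀ ω + (∫ r in t₀..v, A (X r ω)) + _ at e2
    rw [e1, e2, ← this, map_sub, map_sub]
    abel

end Pathwise

/-! ### Recognizing multivariate Gaussian laws -/

/-- The characteristic function of a Gaussian law involves only the mean and the variances of the
one-dimensional projections, so no off-diagonal covariances need to be computed. -/
lemma hasLaw_multivariateGaussian {Ω ι : Type*} {mΩ : MeasurableSpace Ω} {P : Measure Ω}
    [Fintype ι] [DecidableEq ι] {Y : Ω → EuclideanSpace ℝ ι} {m : EuclideanSpace ℝ ι}
    {C : Matrix ι ι ℝ} (hC : C.PosSemidef) (hY : HasGaussianLaw Y P) (hm : ∫ ω, Y ω ∂P = m)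
    (hv : ∀ x : EuclideanSpace ℝ ι, Var[fun ω ↦ inner ℝ x (Y ω); P] = x.ofLp ⬝ᵥ C *ᵥ x.ofLp) :
    HasLaw Y (multivariateGaussian m C) P where
  aemeasurable := hY.aemeasurable
  map_eq := by
    have := hY.isGaussian_map
    refine Measure.ext_of_charFun (funext fun x ↦ ?_)
    rw [charFun_multivariateGaussian hC, IsGaussian.charFun_eq,
      variance_map (by fun_prop) hY.aemeasurable, integral_map hY.aemeasurable (by fun_prop)]
    congr 3
    · rw [integral_complex_ofReal, integral_inner hY.integrable, hm]
    · rw [← hv]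
      rfl

lemma _root_.ProbabilityTheory.HasLaw.variance_inner_multivariateGaussian {Ω ι : Type*}
    {mΩ : MeasurableSpace Ω} {P : Measure Ω} [Fintype ι] [DecidableEq ι]
    {Y : Ω → EuclideanSpace ℝ ι} {m : EuclideanSpace ℝ ι} {C : Matrix ι ι ℝ} (hC : C.PosSemidef)
    (hY : HasLaw Y (multivariateGaussian m C) P) (x : EuclideanSpace ℝ ι) :
    Var[fun ω ↦ inner ℝ x (Y ω); P] = x.ofLp ⬝ᵥ C *ᵥ x.ofLp := by
  rw [← covarianceBilin_multivariateGaussian (μ := m) hC,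
    covarianceBilin_self IsGaussian.memLp_two_id, ← hY.map_eq,
    variance_map (by fun_prop) hY.aemeasurable]
  rfl

lemma _root_.ProbabilityTheory.HasLaw.hasGaussianLaw_multivariateGaussian {Ω ι : Type*}
    {mΩ : MeasurableSpace Ω} {P : Measure Ω} [Fintype ι] [DecidableEq ι]
    {Y : Ω → EuclideanSpace ℝ ι} {m : EuclideanSpace ℝ ι} {C : Matrix ι ι ℝ}
    (hY : HasLaw Y (multivariateGaussian m C) P) : HasGaussianLaw Y P :=
  ⟨by rw [hY.map_eq]; infer_instance⟩

/-! ### Gaussian structure of the Wiener process -/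

section Wiener

variable {Ω ι κ : Type*} {mΩ : MeasurableSpace Ω} [Fintype κ] [DecidableEq κ]
  {P : Measure Ω} {S : Matrix κ κ ℝ} {t₀ : ℝ} {W : ℝ → Ω → EuclideanSpace ℝ κ}

lemma IsWienerProcess.isGaussianProcess (hW : IsWienerProcess S t₀ W P) :
    IsGaussianProcess (fun t : Ici t₀ ↦ W t) P := by
  refine HasIndepIncrements.isGaussianProcess (fun t ↦ ?_) hW.start hW.indep_increments
  refine (hW.law_increments t₀ t le_rfl t.2).hasGaussianLaw_multivariateGaussian.congr ?_
  filter_upwards [hW.start] with ω hω using by simp [hω]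

lemma IsWienerProcess.hasGaussianLaw_sub (hW : IsWienerProcess S t₀ W P) {s t : ℝ} (hs : t₀ ≤ s)
    (hst : s ≤ t) : HasGaussianLaw (fun ω ↦ W t ω - W s ω) P :=
  (hW.law_increments s t hs hst).hasGaussianLaw_multivariateGaussian

lemma IsWienerProcess.indepFun_sub_sub (hW : IsWienerProcess S t₀ W P) {a b c d : ℝ}
    (ha : t₀ ≤ a) (hab : a ≤ b) (hbc : b ≤ c) (hcd : c ≤ d) :
    IndepFun (fun ω ↦ W b ω - W a ω) (fun ω ↦ W d ω - W c ω) P := by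
  -- The four times, continued constantly, form a monotone sequence; the two increments in question
  -- are numbers `0` and `2`, with the gap `[b, c]` between them.
  let τ : ℕ → Ici t₀
    | 0 => ⟨a, ha⟩
    | 1 => ⟨b, ha.trans hab⟩
    | 2 => ⟨c, (ha.trans hab).trans hbc⟩
    | _ => ⟨d, ((ha.trans hab).trans hbc).trans hcd⟩
  have hτ : Monotone τ := by
    refine monotone_nat_of_le_succ fun n ↦ ?_
    match n with
    | 0 => exact hab
    | 1 => exact hbc
    | 2 => exact hcd
    | _ + 3 => exact le_rfl
  exact (hW.indep_increments.nat hτ).indepFun (i := 0) (j := 2) (by norm_num)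

variable [Fintype ι] {X₀ : Ω → EuclideanSpace ℝ ι}

/-- Independent Gaussian vectors are jointly Gaussian. Repeating `X₀` at every time lets one process
carry both the noise and the initial state, each recoverable by a linear map. -/
lemma IsWienerProcess.isGaussianProcess_prodMk (hW : IsWienerProcess S t₀ W P)
    (hX₀ : HasGaussianLaw X₀ P) (hindep : IndepFun X₀ (fun ω (t : Ici t₀) ↦ W t ω) P) :
    IsGaussianProcess (fun (t : Ici t₀) ω ↦ (X₀ ω, W t ω)) P where
  hasGaussianLaw I := by
    have h := (hindep.comp (φ := id) (ψ := fun f ↦ I.restrict f) measurable_id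
      (Finset.measurable_restrict I)).hasGaussianLaw hX₀ (hW.isGaussianProcess.hasGaussianLaw I)
    let L : EuclideanSpace ℝ ι × (I → EuclideanSpace ℝ κ) →L[ℝ]
        (I → EuclideanSpace ℝ ι × EuclideanSpace ℝ κ) :=
      ContinuousLinearMap.pi fun i ↦ (ContinuousLinearMap.fst ℝ _ _).prod
        ((ContinuousLinearMap.proj i).comp (ContinuousLinearMap.snd ℝ _ _))
    exact h.map L

lemma IsWienerProcess.memLp_inner_sub (hW : IsWienerProcess S t₀ W P) {s t : ℝ} (hs : t₀ ≤ s)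
    (hst : s ≤ t) (M : Matrix ι κ ℝ) (L : StrongDual ℝ (EuclideanSpace ℝ ι)) :
    MemLp (fun ω ↦ L (M.toEuclideanLin (W t ω - W s ω))) 2 P :=
  ((hW.hasGaussianLaw_sub hs hst).map_fun
    (L.comp M.toEuclideanLin.toContinuousLinearMap)).memLp_two

lemma measurable_dual_toEuclideanLin (M : Matrix ι κ ℝ)
    (L : StrongDual ℝ (EuclideanSpace ℝ ι)) : Measurable fun w ↦ L (M.toEuclideanLin w) :=
  (L.comp M.toEuclideanLin.toContinuousLinearMap).measurable

end Wiener

/-! ### Second moments of the approximating sums -/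

section WienerSum

variable {Ω ι κ : Type*} {mΩ : MeasurableSpace Ω} [Fintype ι] [DecidableEq ι]
  [Fintype κ] [DecidableEq κ] {P : Measure Ω} {F : Matrix ι ι ℝ} {G : Matrix ι κ ℝ}
  {S : Matrix κ κ ℝ} {t₀ : ℝ} {W : ℝ → Ω → EuclideanSpace ℝ κ} {X : ℝ → Ω → EuclideanSpace ℝ ι}
  {X₀ : Ω → EuclideanSpace ℝ ι}

/-- The pairs `(s, t)` with `t₀ ≤ s ≤ t`. -/
abbrev TimePair (t₀ : ℝ) : Type := {p : ℝ × ℝ // t₀ ≤ p.1 ∧ p.1 ≤ p.2}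

/-- The initial state, together with the approximate residuals over all intervals. -/
noncomputable def approxResidual (F : Matrix ι ι ℝ) (G : Matrix ι κ ℝ) (t₀ : ℝ)
    (W : ℝ → Ω → EuclideanSpace ℝ κ) (X₀ : Ω → EuclideanSpace ℝ ι) (n : ℕ) :
    Option (TimePair t₀) → Ω → EuclideanSpace ℝ ι
  | none => X₀
  | some p => wienerSum F G W n p.1.1 p.1.2

/-- The initial state, together with the residuals over all intervals. -/
noncomputable def residual (F : Matrix ι ι ℝ) (t₀ : ℝ) (X : ℝ → Ω → EuclideanSpace ℝ ι) :
    Option (TimePair t₀) → Ω → EuclideanSpace ℝ ι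
  | none => X t₀
  | some p => fun ω ↦ X p.1.2 ω - (transition F (p.1.2 - p.1.1)).toEuclideanLin (X p.1.1 ω)

/-- Every member of the family is a linear image of finitely many values of `(X₀, W)`. Treating all
intervals and the initial state as one process gives the joint Gaussianity needed for covariances in
the limit. -/
lemma IsWienerProcess.isGaussianProcess_approxResidual (hW : IsWienerProcess S t₀ W P)
    (hX₀ : HasGaussianLaw X₀ P) (hindep : IndepFun X₀ (fun ω (t : Ici t₀) ↦ W t ω) P) (n : ℕ) :
    IsGaussianProcess (approxResidual F G t₀ W X₀ n) P := by
  classical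
  have hV := hW.isGaussianProcess_prodMk hX₀ hindep
  refine hV.of_isGaussianProcess fun p ↦ ?_
  match p with
  | none =>
    exact ⟨{⟨t₀, self_mem_Ici⟩}, (ContinuousLinearMap.fst ℝ _ _).comp
      (ContinuousLinearMap.proj ⟨⟨t₀, self_mem_Ici⟩, by simp⟩), fun ω ↦ rfl⟩
  | some ⟨(s, t), hs, hst⟩ =>
    let τ : ℕ → Ici t₀ := fun k ↦ ⟨gridPoint s t n k, hs.trans (le_gridPoint hst n k)⟩
    let I : Finset (Ici t₀) := (Finset.range (n + 1)).image τ
    have hI : ∀ k ≤ n, τ k ∈ I := fun k hk ↦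
      Finset.mem_image_of_mem _ (Finset.mem_range.2 (Nat.lt_succ_of_le hk))
    let pr : ∀ k ≤ n, (I → EuclideanSpace ℝ ι × EuclideanSpace ℝ κ) →L[ℝ] EuclideanSpace ℝ κ :=
      fun k hk ↦ (ContinuousLinearMap.snd ℝ _ _).comp
        (ContinuousLinearMap.proj ⟨τ k, hI k hk⟩)
    refine ⟨I, ∑ k : Fin n,
      (transition F (t - gridPoint s t n k) * G).toEuclideanLin.toContinuousLinearMap.comp
        (pr (k + 1) k.2 - pr k k.2.le), fun ω ↦ ?_⟩
    simp only [approxResidual, wienerSum, Finset.sum_range]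
    simp [pr, τ]

lemma IsWienerProcess.integral_wienerSum (hW : IsWienerProcess S t₀ W P) {s t : ℝ}
    (hs : t₀ ≤ s) (hst : s ≤ t) (n : ℕ) : ∫ ω, wienerSum F G W n s t ω ∂P = 0 := by
  have hg : ∀ k, HasGaussianLaw
      (fun ω ↦ W (gridPoint s t n (k + 1)) ω - W (gridPoint s t n k) ω) P := fun k ↦
    hW.hasGaussianLaw_sub (hs.trans (le_gridPoint hst n k))
      (monotone_gridPoint hst n (Nat.le_succ k))
  simp only [wienerSum]
  rw [integral_finsetSum]
  · refine Finset.sum_eq_zero fun k _ ↦ ?_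
    have h := (transition F (t - gridPoint s t n k) *
      G).toEuclideanLin.toContinuousLinearMap.integral_comp_comm (hg k).integrable
    rw [(hW.law_increments _ _ (hs.trans (le_gridPoint hst n k))
      (monotone_gridPoint hst n (Nat.le_succ k))).integral_eq,
      integral_id_multivariateGaussian, map_zero] at h
    exact h
  · exact fun k _ ↦ (transition F (t - gridPoint s t n k) *
      G).toEuclideanLin.toContinuousLinearMap.integrable_comp (hg k).integrable

lemma IsWienerProcess.covariance_wienerSum_initial [IsProbabilityMeasure P]
    (hW : IsWienerProcess S t₀ W P)
    (hX₀ : HasGaussianLaw X₀ P) (hindep : IndepFun X₀ (fun ω (t : Ici t₀) ↦ W t ω) P)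
    {s t : ℝ} (hs : t₀ ≤ s) (hst : s ≤ t) (n : ℕ) (L M : StrongDual ℝ (EuclideanSpace ℝ ι)) :
    cov[fun ω ↦ L (wienerSum F G W n s t ω), fun ω ↦ M (X₀ ω); P] = 0 := by
  have hgrid : ∀ k, t₀ ≤ gridPoint s t n k := fun k ↦ hs.trans (le_gridPoint hst n k)
  have hLp := fun k ↦ hW.memLp_inner_sub (hgrid k) (monotone_gridPoint hst n (Nat.le_succ k))
    (transition F (t - gridPoint s t n k) * G) L
  have hM := (hX₀.map_fun M).memLp_two
  simp only [wienerSum, map_sum]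
  rw [covariance_fun_sum_left' (fun k _ ↦ hLp k) hM]
  refine Finset.sum_eq_zero fun k _ ↦ IndepFun.covariance_eq_zero ?_ (hLp k) hM
  refine (hindep.comp (φ := fun x ↦ M x) (ψ := fun w : Ici t₀ → EuclideanSpace ℝ κ ↦
    L ((transition F (t - gridPoint s t n k) * G).toEuclideanLin
      (w ⟨gridPoint s t n (k + 1), hgrid (k + 1)⟩ - w ⟨gridPoint s t n k, hgrid k⟩)))
    M.measurable ?_).symm
  exact (measurable_dual_toEuclideanLin _ L).comp
    ((measurable_pi_apply _).sub (measurable_pi_apply _))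

/-- All increments in one sum precede all increments in the other, so every cross term is a
covariance of independent variables. -/
lemma IsWienerProcess.covariance_wienerSum_wienerSum [IsProbabilityMeasure P]
    (hW : IsWienerProcess S t₀ W P) {u v s t : ℝ} (hu : t₀ ≤ u) (huv : u ≤ v) (hvs : v ≤ s)
    (hst : s ≤ t) (n : ℕ) (L M : StrongDual ℝ (EuclideanSpace ℝ ι)) :
    cov[fun ω ↦ L (wienerSum F G W n s t ω), fun ω ↦ M (wienerSum F G W n u v ω); P] = 0 := by
  have hs := (hu.trans huv).trans hvs
  have hLp := fun k ↦ hW.memLp_inner_sub (hs.trans (le_gridPoint hst n k))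
    (monotone_gridPoint hst n (Nat.le_succ k)) (transition F (t - gridPoint s t n k) * G) L
  have hMp := fun k ↦ hW.memLp_inner_sub (hu.trans (le_gridPoint huv n k))
    (monotone_gridPoint huv n (Nat.le_succ k)) (transition F (v - gridPoint u v n k) * G) M
  simp only [wienerSum, map_sum]
  rw [covariance_fun_sum_fun_sum' (fun k _ ↦ hLp k) (fun k _ ↦ hMp k)]
  refine Finset.sum_eq_zero fun k _ ↦ Finset.sum_eq_zero fun j hj ↦
    IndepFun.covariance_eq_zero ?_ (hLp k) (hMp j)
  have hj' : j + 1 ≤ n := Nat.succ_le_of_lt (Finset.mem_range.1 hj)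
  exact ((hW.indepFun_sub_sub (hu.trans (le_gridPoint huv n j))
    (monotone_gridPoint huv n (Nat.le_succ j))
    (((gridPoint_mem_Icc huv hj').2.trans hvs).trans (le_gridPoint hst n k))
    (monotone_gridPoint hst n (Nat.le_succ k))).comp (measurable_dual_toEuclideanLin _ M)
    (measurable_dual_toEuclideanLin _ L)).symm

/-- Increments over distinct cells are independent, so variances add; each cell contributes its
length times the form of `S` at the transposed coefficient matrix applied to `x`. -/
lemma IsWienerProcess.variance_inner_wienerSum (hS : S.PosSemidef)
    (hW : IsWienerProcess S t₀ W P) {s t : ℝ} (hs : t₀ ≤ s) (hst : s ≤ t) (n : ℕ)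
    (x : EuclideanSpace ℝ ι) :
    Var[fun ω ↦ inner ℝ x (wienerSum F G W n s t ω); P] =
      ∑ k ∈ Finset.range n, ((t - s) / n) • (x.ofLp ⬝ᵥ (transition F (t - gridPoint s t n k) * G *
        S * Gᵀ * (transition F (t - gridPoint s t n k))ᵀ) *ᵥ x.ofLp) := by
  have hgrid : ∀ k, t₀ ≤ gridPoint s t n k := fun k ↦ hs.trans (le_gridPoint hst n k)
  have hmono := monotone_gridPoint hst n
  let Y : ℕ → Ω → ℝ := fun k ω ↦ innerSL ℝ x ((transition F (t - gridPoint s t n k) *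
    G).toEuclideanLin (W (gridPoint s t n (k + 1)) ω - W (gridPoint s t n k) ω))
  have hsum : (fun ω ↦ inner ℝ x (wienerSum F G W n s t ω)) = ∑ k ∈ Finset.range n, Y k := by
    ext ω
    simp only [Y, wienerSum, inner_sum, Finset.sum_apply, innerSL_apply_apply]
  rw [hsum, IndepFun.variance_sum
    (fun k _ ↦ hW.memLp_inner_sub (hgrid k) (hmono (Nat.le_succ k)) _ (innerSL ℝ x))]
  · refine Finset.sum_congr rfl fun k _ ↦ ?_
    have hlaw := hW.law_increments _ _ (hgrid k) (hmono (Nat.le_succ k))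
    rw [Nat.succ_eq_add_one, gridPoint_succ_sub] at hlaw
    have hpos : 0 ≤ (t - s) / n := div_nonneg (by linarith) (Nat.cast_nonneg n)
    simp only [innerSL_apply_apply, inner_toEuclideanLin]
    rw [hlaw.variance_inner_multivariateGaussian (hS.smul hpos)]
    simp only [Matrix.ofLp_toLpLin, Matrix.toLin'_apply, Matrix.smul_mulVec, dotProduct_smul]
    congr 1
    have hM : transition F (t - gridPoint s t n k) * G * S * Gᵀ *
        (transition F (t - gridPoint s t n k))ᵀ = transition F (t - gridPoint s t n k) * G * S *
          (transition F (t - gridPoint s t n k) * G)ᵀ := by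
      rw [Matrix.transpose_mul, Matrix.mul_assoc _ Gᵀ]
    rw [hM, ← Matrix.mulVec_mulVec, ← Matrix.mulVec_mulVec, Matrix.dotProduct_mulVec x.ofLp,
      ← Matrix.mulVec_transpose]
  · intro i hi j hj hij
    wlog hlt : i < j generalizing i j
    · exact (this hj hi hij.symm (lt_of_le_of_ne (not_lt.1 hlt) hij.symm)).symm
    · exact (hW.indepFun_sub_sub (hgrid i) (hmono (Nat.le_succ i)) (hmono hlt)
        (hmono (Nat.le_succ j))).comp (measurable_dual_toEuclideanLin _ _)
        (measurable_dual_toEuclideanLin _ _)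

end WienerSum

/-! ### Passing to the limit: residuals, independence and laws -/

section Residual

variable {Ω ι κ : Type*} {mΩ : MeasurableSpace Ω} [Fintype ι] [DecidableEq ι]
  [Fintype κ] [DecidableEq κ] {P : Measure Ω} {F : Matrix ι ι ℝ} {G : Matrix ι κ ℝ}
  {S : Matrix κ κ ℝ} {t₀ : ℝ} {W : ℝ → Ω → EuclideanSpace ℝ κ} {X : ℝ → Ω → EuclideanSpace ℝ ι}

lemma IsSolution.tendsto_approxResidual (hX : IsSolution F G t₀ W X P)
    (hW : IsWienerProcess S t₀ W P) (p : Option (TimePair t₀)) :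
    ∀ᵐ ω ∂P, Tendsto (fun n ↦ approxResidual F G t₀ W (X t₀) n p ω) atTop
      (𝓝 (residual F t₀ X p ω)) := by
  match p with
  | none => exact ae_of_all _ fun ω ↦ tendsto_const_nhds
  | some ⟨(s, t), hs, hst⟩ =>
    filter_upwards [hX.tendsto_wienerSum hW] with ω hω using hω s t hs hst

lemma IsWienerProcess.integral_approxResidual (hW : IsWienerProcess S t₀ W P)
    (n : ℕ) (p : Option (TimePair t₀)) :
    ∫ ω, approxResidual F G t₀ W (X t₀) n p ω ∂P = p.elim (∫ ω, X t₀ ω ∂P) fun _ ↦ 0 := by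
  match p with
  | none => rfl
  | some ⟨(s, t), hs, hst⟩ => exact hW.integral_wienerSum hs hst n

variable (hX : IsSolution F G t₀ W X P) (hW : IsWienerProcess S t₀ W P)
  (hX₀ : HasGaussianLaw (X t₀) P) (hindep : IndepFun (X t₀) (fun ω (t : Ici t₀) ↦ W t ω) P)

include hX hW hX₀ hindep

lemma IsSolution.isGaussianProcess_residual : IsGaussianProcess (residual F t₀ X) P :=
  isGaussianProcess_of_tendsto
    (fun n ↦ hW.isGaussianProcess_approxResidual (F := F) (G := G) hX₀ hindep n)
    (fun n p ↦ hW.integral_approxResidual n p) (hX.tendsto_approxResidual hW)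

lemma IsSolution.tendsto_covariance_residual (p q : Option (TimePair t₀))
    (L M : StrongDual ℝ (EuclideanSpace ℝ ι)) :
    Tendsto (fun n ↦ cov[fun ω ↦ L (approxResidual F G t₀ W (X t₀) n p ω),
        fun ω ↦ M (approxResidual F G t₀ W (X t₀) n q ω); P]) atTop
      (𝓝 cov[fun ω ↦ L (residual F t₀ X p ω), fun ω ↦ M (residual F t₀ X q ω); P]) :=
  tendsto_covariance_of_tendsto (fun n ↦ hW.isGaussianProcess_approxResidual hX₀ hindep n)
    (fun n p ↦ hW.integral_approxResidual n p) (hX.tendsto_approxResidual hW) p q L M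

/-- The state at time `t` is the residual over `[t₀, t]` plus `Φ(t - t₀)` applied to the initial
state, a linear function of the Gaussian family `residual`. -/
lemma IsSolution.isGaussianProcess : IsGaussianProcess (fun t : Ici t₀ ↦ X t) P := by
  classical
  have hZ := hX.isGaussianProcess_residual hW hX₀ hindep
  refine hZ.of_isGaussianProcess fun t ↦ ?_
  let p : Option (TimePair t₀) := some ⟨(t₀, t), le_rfl, t.2⟩
  let I : Finset (Option (TimePair t₀)) := {none, p}
  let pr (q : I) : (I → EuclideanSpace ℝ ι) →L[ℝ] EuclideanSpace ℝ ι := ContinuousLinearMap.proj q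
  refine ⟨I, pr ⟨p, by simp [I]⟩ +
    (transition F (t - t₀)).toEuclideanLin.toContinuousLinearMap.comp
      (pr ⟨none, by simp [I]⟩), fun ω ↦ ?_⟩
  simp [pr, p, residual]

/-- Splitting `X u` into the residual over `[t₀, u]` and a linear image of `X t₀` leaves two
covariances, each the limit of a sequence that is identically zero. -/
lemma IsSolution.covariance_residual_eq_zero {u s t : ℝ} (hu : t₀ ≤ u) (hus : u ≤ s) (hst : s ≤ t)
    (L M : StrongDual ℝ (EuclideanSpace ℝ ι)) :
    cov[fun ω ↦ L (X t ω - (transition F (t - s)).toEuclideanLin (X s ω)),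
      fun ω ↦ M (X u ω); P] = 0 := by
  have := hX₀.isProbabilityMeasure
  have hs := hu.trans hus
  let p : Option (TimePair t₀) := some ⟨(s, t), hs, hst⟩
  let q : Option (TimePair t₀) := some ⟨(t₀, u), le_rfl, hu⟩
  have hZ := hX.isGaussianProcess_residual hW hX₀ hindep
  let N := M.comp (transition F (u - t₀)).toEuclideanLin.toContinuousLinearMap
  have hXu : (fun ω ↦ M (X u ω)) =
      (fun ω ↦ M (residual F t₀ X q ω)) + fun ω ↦ N (residual F t₀ X none ω) := by
    ext ω
    simp [q, N, residual]
  have hLp : ∀ r (L : StrongDual ℝ (EuclideanSpace ℝ ι)),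
      MemLp (fun ω ↦ L (residual F t₀ X r ω)) 2 P := fun r L ↦
    ((hZ.hasGaussianLaw_eval r).map_fun L).memLp_two
  rw [hXu]
  change cov[fun ω ↦ L (residual F t₀ X p ω), _; P] = 0
  rw [covariance_add_right (hLp p L) (hLp q M) (hLp none N)]
  have h1 : cov[fun ω ↦ L (residual F t₀ X p ω), fun ω ↦ N (residual F t₀ X none ω); P] = 0 :=
    tendsto_nhds_unique (hX.tendsto_covariance_residual hW hX₀ hindep p none L N)
      (tendsto_const_nhds.congr fun n ↦
        (hW.covariance_wienerSum_initial hX₀ hindep hs hst n L N).symm)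
  have h2 : cov[fun ω ↦ L (residual F t₀ X p ω), fun ω ↦ M (residual F t₀ X q ω); P] = 0 := by
    refine tendsto_nhds_unique (hX.tendsto_covariance_residual hW hX₀ hindep p q L M)
      (tendsto_const_nhds.congr fun n ↦ ?_)
    exact (hW.covariance_wienerSum_wienerSum le_rfl hu hus hst n L M).symm
  rw [h1, h2, add_zero]

lemma IsSolution.variance_inner_residual (hS : S.PosSemidef) {s t : ℝ} (hs : t₀ ≤ s) (hst : s ≤ t)
    (x : EuclideanSpace ℝ ι) :
    Var[fun ω ↦ inner ℝ x (X t ω - (transition F (t - s)).toEuclideanLin (X s ω)); P] =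
      x.ofLp ⬝ᵥ noiseCov F G S (t - s) *ᵥ x.ofLp := by
  let p : Option (TimePair t₀) := some ⟨(s, t), hs, hst⟩
  have h := hX.tendsto_covariance_residual hW hX₀ hindep p p (innerSL ℝ x) (innerSL ℝ x)
  rw [covariance_self (((hX.isGaussianProcess_residual hW hX₀ hindep).hasGaussianLaw_eval
    p).map_fun (innerSL ℝ x)).aemeasurable] at h
  refine tendsto_nhds_unique h ((tendsto_sum_noise_integrand F G S hst x).congr fun n ↦ ?_)
  rw [covariance_self (((hW.isGaussianProcess_approxResidual (F := F) (G := G) hX₀ hindep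
    n).hasGaussianLaw_eval p).map_fun (innerSL ℝ x)).aemeasurable]
  exact (hW.variance_inner_wienerSum hS hs hst n x).symm

lemma IsSolution.hasGaussianLaw_residual {s t : ℝ} (hs : t₀ ≤ s) (hst : s ≤ t) :
    HasGaussianLaw (fun ω ↦ X t ω - (transition F (t - s)).toEuclideanLin (X s ω)) P :=
  (hX.isGaussianProcess_residual hW hX₀ hindep).hasGaussianLaw_eval (some ⟨(s, t), hs, hst⟩)

lemma IsSolution.integral_residual {s t : ℝ} (hs : t₀ ≤ s) (hst : s ≤ t) :
    ∫ ω, (X t ω - (transition F (t - s)).toEuclideanLin (X s ω)) ∂P = 0 := by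
  let p : Option (TimePair t₀) := some ⟨(s, t), hs, hst⟩
  exact integral_eq_of_tendsto_gaussian
    (fun n ↦ (hW.isGaussianProcess_approxResidual hX₀ hindep n).hasGaussianLaw_eval p)
    (fun n ↦ hW.integral_approxResidual n p)
    ((hX.isGaussianProcess_residual hW hX₀ hindep).hasGaussianLaw_eval p)
    (hX.tendsto_approxResidual hW p)

lemma IsSolution.hasLaw_residual (hS : S.PosSemidef) {s t : ℝ} (hs : t₀ ≤ s) (hst : s ≤ t) :
    HasLaw (fun ω ↦ X t ω - (transition F (t - s)).toEuclideanLin (X s ω))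
      (multivariateGaussian 0 (noiseCov F G S (t - s))) P :=
  hasLaw_multivariateGaussian (posSemidef_noiseCov F G hS (sub_nonneg.2 hst))
    (hX.hasGaussianLaw_residual hW hX₀ hindep hs hst) (hX.integral_residual hW hX₀ hindep hs hst)
    (hX.variance_inner_residual hW hX₀ hindep hS hs hst)

lemma IsSolution.indepFun_residual {s t : ℝ} (hs : t₀ ≤ s) (hst : s ≤ t) :
    IndepFun (fun ω ↦ X t ω - (transition F (t - s)).toEuclideanLin (X s ω))
      (fun ω (u : Icc t₀ s) ↦ X u ω) P := by
  classical
  have hXg := hX.isGaussianProcess hW hX₀ hindep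
  -- The independence criterion compares two families inside one Gaussian process, so the single
  -- residual is made a family over a one-point index.
  let R : Unit → Ω → EuclideanSpace ℝ ι :=
    fun _ ω ↦ X t ω - (transition F (t - s)).toEuclideanLin (X s ω)
  let Y : Icc t₀ s → Ω → EuclideanSpace ℝ ι := fun u ↦ X u
  have hjoint : IsGaussianProcess (Sum.elim R Y) P := by
    refine hXg.of_isGaussianProcess fun a ↦ ?_
    match a with
    | .inl _ =>
      let a : Ici t₀ := ⟨t, hs.trans hst⟩
      let b : Ici t₀ := ⟨s, hs⟩
      let I : Finset (Ici t₀) := {a, b}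
      let pr (q : I) : (I → EuclideanSpace ℝ ι) →L[ℝ] EuclideanSpace ℝ ι :=
        ContinuousLinearMap.proj q
      refine ⟨I, pr ⟨a, by simp [I]⟩ -
        (transition F (t - s)).toEuclideanLin.toContinuousLinearMap.comp
          (pr ⟨b, by simp [I]⟩), fun ω ↦ ?_⟩
      simp [R, pr, a, b]
    | .inr u =>
      exact ⟨{⟨u, u.2.1⟩}, ContinuousLinearMap.proj ⟨⟨u, u.2.1⟩, by simp⟩, fun ω ↦ rfl⟩
  have h := hjoint.indepFun_of_covariance_strongDual (fun a ↦ hjoint.aemeasurable (.inl a))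
    (fun u ↦ hjoint.aemeasurable (.inr u)) fun _ u L M ↦
      hX.covariance_residual_eq_zero hW hX₀ hindep u.2.1 u.2.2 hst L M
  exact h.comp (φ := fun f : Unit → EuclideanSpace ℝ ι ↦ f ()) (ψ := id) (measurable_pi_apply ())
    measurable_id

lemma IsSolution.isLinearGaussianProcess (hS : S.PosSemidef) :
    IsLinearGaussianProcess (transition F) (noiseCov F G S) t₀ X P where
  gaussian := hX.isGaussianProcess hW hX₀ hindep
  cov_posSemidef _ _ _ hst := posSemidef_noiseCov F G hS (sub_nonneg.2 hst)
  law_residual _ _ hs hst := hX.hasLaw_residual hW hX₀ hindep hS hs hst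
  indep_residual _ _ hs hst := hX.indepFun_residual hW hX₀ hindep hs hst

-- The residual over `[t₀, t]` and `Φ(t - t₀) X t₀` are uncorrelated, so both means and variances of
-- projections add.
omit hX₀ in
lemma IsSolution.hasLaw {μ₀ : EuclideanSpace ℝ ι} {P₀ : Matrix ι ι ℝ} (hS : S.PosSemidef)
    (hP₀ : P₀.PosSemidef) (hinit : HasLaw (X t₀) (multivariateGaussian μ₀ P₀) P) {t : ℝ}
    (ht : t₀ ≤ t) :
    HasLaw (X t) (multivariateGaussian ((transition F (t - t₀)).toEuclideanLin μ₀)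
      (errorCov F G S P₀ (t - t₀))) P := by
  have hX₀ := hinit.hasGaussianLaw_multivariateGaussian
  have := hX₀.isProbabilityMeasure
  let Φ := (transition F (t - t₀)).toEuclideanLin.toContinuousLinearMap
  have hres : HasGaussianLaw (fun ω ↦ X t ω - Φ (X t₀ ω)) P :=
    hX.hasGaussianLaw_residual hW hX₀ hindep le_rfl ht
  have hΦ : HasGaussianLaw (fun ω ↦ Φ (X t₀ ω)) P := hX₀.map_fun Φ
  have hXt : X t = fun ω ↦ (X t ω - Φ (X t₀ ω)) + Φ (X t₀ ω) := by
    ext1 ω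
    rw [sub_add_cancel]
  refine hasLaw_multivariateGaussian (posSemidef_errorCov F G hS hP₀ (sub_nonneg.2 ht))
    ((hX.isGaussianProcess hW hX₀ hindep).hasGaussianLaw_eval ⟨t, ht⟩) ?_ fun x ↦ ?_
  · have h0 : ∫ ω, (X t ω - Φ (X t₀ ω)) ∂P = 0 := hX.integral_residual hW hX₀ hindep le_rfl ht
    rw [hXt]
    change ∫ ω, (X t ω - Φ (X t₀ ω) + Φ (X t₀ ω)) ∂P = Φ μ₀
    rw [integral_add hres.integrable hΦ.integrable, h0, zero_add,
      Φ.integral_comp_comm hX₀.integrable, hinit.integral_eq, integral_id_multivariateGaussian]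
  · have hcov : cov[fun ω ↦ inner ℝ x (X t ω - Φ (X t₀ ω)),
        fun ω ↦ inner ℝ x (Φ (X t₀ ω)); P] = 0 :=
      hX.covariance_residual_eq_zero hW hX₀ hindep le_rfl le_rfl ht (innerSL ℝ x)
        ((innerSL ℝ x).comp Φ)
    have hvar : Var[fun ω ↦ inner ℝ x (X t ω - Φ (X t₀ ω)); P] =
        x.ofLp ⬝ᵥ noiseCov F G S (t - t₀) *ᵥ x.ofLp :=
      hX.variance_inner_residual hW hX₀ hindep hS le_rfl ht x
    have hvar₀ : Var[fun ω ↦ inner ℝ x (Φ (X t₀ ω)); P] =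
        x.ofLp ⬝ᵥ (transition F (t - t₀) * P₀ * (transition F (t - t₀))ᵀ) *ᵥ x.ofLp := by
      simp only [Φ, LinearMap.coe_toContinuousLinearMap', inner_toEuclideanLin]
      rw [hinit.variance_inner_multivariateGaussian hP₀]
      simp only [Matrix.ofLp_toLpLin, Matrix.toLin'_apply]
      rw [← Matrix.mulVec_mulVec, ← Matrix.mulVec_mulVec, Matrix.dotProduct_mulVec x.ofLp,
        ← Matrix.mulVec_transpose]
    rw [hXt]
    simp only [inner_add_right]
    have hLp : MemLp (fun ω ↦ inner ℝ x (X t ω - Φ (X t₀ ω))) 2 P :=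
      (hres.map_fun (innerSL ℝ x)).memLp_two
    have hLp₀ : MemLp (fun ω ↦ inner ℝ x (Φ (X t₀ ω))) 2 P :=
      (hΦ.map_fun (innerSL ℝ x)).memLp_two
    rw [variance_fun_add hLp hLp₀, hcov, hvar, hvar₀, errorCov, Matrix.add_mulVec, dotProduct_add]
    ring

end Residual

end ErrorState

theorem proposition3 {Ω ι κ : Type*} {mΩ : MeasurableSpace Ω} [Fintype ι] [DecidableEq ι]
    [Fintype κ] [DecidableEq κ] (P : Measure Ω) [IsProbabilityMeasure P]
    (F : Matrix ι ι ℝ) (G : Matrix ι κ ℝ) (S : Matrix κ κ ℝ) (hS : S.PosSemidef)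
    (μ₀ : EuclideanSpace ℝ ι) (P₀ : Matrix ι ι ℝ) (hP₀ : P₀.PosSemidef) (t₀ : ℝ)
    (W : ℝ → Ω → EuclideanSpace ℝ κ) (hW : ErrorState.IsWienerProcess S t₀ W P)
    (δx : ℝ → Ω → EuclideanSpace ℝ ι) (hδx : ErrorState.IsSolution F G t₀ W δx P)
    (hinit : HasLaw (δx t₀) (multivariateGaussian μ₀ P₀) P)
    (hindep : IndepFun (δx t₀) (fun ω (t : Set.Ici t₀) ↦ W t ω) P) :
    (∀ t : ℝ, t₀ ≤ t →
      (ErrorState.errorCov F G S P₀ (t - t₀)).PosSemidef ∧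
      HasLaw (δx t)
        (multivariateGaussian ((ErrorState.transition F (t - t₀)).toEuclideanLin μ₀)
          (ErrorState.errorCov F G S P₀ (t - t₀))) P) ∧
    ErrorState.IsLinearGaussianProcess (ErrorState.transition F) (ErrorState.noiseCov F G S)
      t₀ δx P := by
  have hX₀ := hinit.hasGaussianLaw_multivariateGaussian
  exact ⟨fun t ht ↦ ⟨ErrorState.posSemidef_errorCov F G hS hP₀ (sub_nonneg.2 ht),
    hδx.hasLaw hW hindep hS hP₀ hinit ht⟩, hδx.isLinearGaussianProcess hW hX₀ hindep hS⟩
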